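/- Let $\mathcal M$ be a first-order structure with universe $M$, in an arbitrary language. For $A\subseteq M$ let $\operatorname{acl}(A)$ be the union of all finite subsets of $M$ that are definable with parameters from $A$. Assume that $\mathcal M$ is a geometric structure, that is: 1. (Exchange) for all $C\subseteq M$ and $a,b\in M$, if $a\in\operatorname{acl}(C\cup\{b\})\setminus\operatorname{acl}(C)$ then $b\in\operatorname{acl}(C\cup\{a\})$; 2. (Uniform finiteness) for every formula $\psi(y,\mathbf x)$ there is $k\in\mathbb N$ such that for every tuple $\mathbf a$ from $M$ the set $\{b\in M:\mathcal M\models\psi(b,\mathbf a)\}$ is infinite or has at most $k$ elements. For a formula $\Phi(x_1,\dots,x_n)$ with parameters from $B\subseteq M$, the dimension of the set defined by $\Phi$ is the largest $d$ for which there are an elementary extension $\mathcal N$ of $\mathcal M$, a tuple $(a_1,\dots,a_n)$ of $\mathcal N$ satisfying $\Phi$, and distinct indices $i_1,\dots,i_d$ such that $a_{i_{j+1}}\notin\operatorname{acl}(\{a_{i_1},\dots,a_{i_j}\}\cup B)$ (computed in $\mathcal N$) for all $0\le j<d$; the empty set has dimension $-\infty$. An $\operatorname{acl}(\emptyset)$-definable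 $n$-curve is a subset of $M^n$ that is definable in $\mathcal M$ with parameters from $\operatorname{acl}(\emptyset)$ and has dimension $\le 1$. An $\operatorname{acl}(\emptyset)$-definable curve-based cylinder in $M^m$ is a set of the form $\{(x_1,\dots,x_m)\in M^m:(x_{i_1},\dots,x_{i_n})\in C\}$ with $n\in\mathbb N$, $1\le i_1<\dots<i_n\le m$ and $C$ an $\operatorname{acl}(\emptyset)$-definable $n$-curve. Let $\mathcal C$ be the structure with universe $M$ and, for every $n\in\mathbb N$, an $n$-ary predicate for each $\operatorname{acl}(\emptyset)$-definable $n$-curve. Then $\mathcal C$ has quantifier elimination: every formula in the language of $\mathcal C$ is equivalent in $\mathcal C$ to a quantifier-free formula in the same variables. Moreover, every formula $\varphi(x_1,\dots,x_n)$ in the language of $\mathcal C$ defines a boolean combination of $\operatorname{acl}(\emptyset)$-definable curve-based cylinders in $M^n$. -/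

import Mathlib

universe u v w

namespace GeometricCurves

open FirstOrder FirstOrder.Language

section

variable (L : FirstOrder.Language.{u, v})

/-- Algebraic closure of a set of parameters: the union of the finite sets definable over it. -/
def acl {M : Type w} [L.Structure M] (A : Set M) : Set M :=
  {b | ∃ S : Set M, A.Definable₁ L S ∧ S.Finite ∧ b ∈ S}

/-- A geometric structure: exchange for `acl`, and uniform finiteness. -/
structure IsGeometric (M : Type w) [L.Structure M] : Prop where
  exchange : ∀ (C : Set M) (a b : M),
    a ∈ acl L (insert b C) → a ∉ acl L C → b ∈ acl L (insert a C)
  uniform_finiteness : ∀ (n : ℕ) (ψ : L.Formula (Fin (n + 1))), ∃ k : ℕ, ∀ a : Fin n → M,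
    {b : M | ψ.Realize (Fin.cons b a)}.Infinite ∨ {b : M | ψ.Realize (Fin.cons b a)}.encard ≤ k

variable {M : Type w} [L.Structure M]

/-- The `acl`-dimension of the set defined by a formula `φ` with parameters in `B`: the largest
length of an `acl`-independent (over `B`) subtuple of a tuple satisfying `φ`, the tuple ranging over
all elementary extensions `N` of `M` (which gives the same value as one saturated extension, since
finite tuples from any elementary extension have their type over `B` realized there). By
Löwenheim-Skolem the universe in which `N` lives loses nothing. The empty set has dimension `⊥`. -/
noncomputable def aclDim {B : Set M} {n : ℕ} (φ : L.Formula (B ⊕ Fin n)) : WithBot ℕ∞ :=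
  ⨆ d : {d : ℕ // ∃ (N : Type (max u v w)) (_ : L.Structure N) (f : M ↪ₑ[L] N)
      (a : Fin n → N) (i : Fin d ↪ Fin n),
      φ.Realize (Sum.elim (fun b : B => f b) a) ∧
      ∀ j : Fin d, a (i j) ∉ acl L ({x | ∃ k < j, x = a (i k)} ∪ f '' B)},
    ((d : ℕ) : WithBot ℕ∞)

/-- `X ⊆ Mⁿ` is an `A`-definable `n`-curve: definable over `A`, of dimension at most `1`. -/
def IsCurve (A : Set M) {n : ℕ} (X : Set (Fin n → M)) : Prop :=
  ∃ φ : L.Formula (A ⊕ Fin n),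
    X = {x | φ.Realize (Sum.elim (fun b : A => (b : M)) x)} ∧ aclDim L φ ≤ 1

/-- `S ⊆ Mᵐ` is an `A`-definable curve-based cylinder: membership in `S` says that the
coordinates at some indices `i₁ < ⋯ < iₙ` form a point of an `A`-definable `n`-curve. -/
def IsCurveBasedCylinder (A : Set M) {m : ℕ} (S : Set (Fin m → M)) : Prop :=
  ∃ (n : ℕ) (i : Fin n ↪o Fin m) (C : Set (Fin n → M)), IsCurve L A C ∧ S = {x | x ∘ i ∈ C}

variable (M)

/-- The relational language with an `n`-ary predicate for every `acl(∅)`-definable `n`-curve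
of `M`, for every `n`. -/
def curveLanguage : FirstOrder.Language.{0, w} where
  Functions _ := Empty
  Relations n := {X : Set (Fin n → M) // IsCurve L (acl L (∅ : Set M)) X}

/-- The structure on `M` in which every predicate is interpreted as its curve. -/
instance curveStructure : (curveLanguage L M).Structure M where
  funMap f := Empty.elim f
  RelMap R x := x ∈ R.1

/-- Quantifier elimination for a structure: every formula is equivalent in it to a quantifier-free
formula in the same variables. -/
def HasQE : Prop :=
  ∀ (n : ℕ) (φ : L.Formula (Fin n)), ∃ ψ : L.Formula (Fin n),
    BoundedFormula.IsQF ψ ∧ ∀ x : Fin n → M, φ.Realize x ↔ ψ.Realize x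

end

end GeometricCurves

/-! Over a geometric structure, dimension at most 1 can be read off inside M: a definable set has it
exactly when, for any two distinct coordinates, all but finitely many values of the first leave only
finitely many values for the second (`ThinOn`, `IsGeometric.isCurve_iff`). After this, elementary
extensions play no role.

Quantifier elimination amounts to projecting a boolean combination of thin cylinders along one
variable y. The exceptional values of a coordinate form a finite set definable over acl(∅), hence
lie in acl(∅) and may be substituted, which leaves fewer coordinates. Away from them, y is
interalgebraic with each other coordinate involved. So the combination is a finite union of sets G ∩
P \ (N₁ ∪ … ∪ Nᵣ) with G free of y, with P and the Nᵢ interalgebraic, and with finite y-slices for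
the Nᵢ (`IsThinCylinder.mem_normalAlgebra`).

If P has an infinite y-slice, it restricts y alone, and the Nᵢ cannot exhaust it. If its slices are
finite, a suitable y exists when the number of points left in the slice is nonzero.
Inclusion-exclusion reduces that number to the sizes of slices of interalgebraic sets, and "at least
m points" is for m ≥ 1 a thin cylinder without y (`IsInteralgebraic.isThinCylinder_count`). Uniform
finiteness keeps the boolean combination finite. -/

namespace GeometricCurves

open FirstOrder FirstOrder.Language Set

/-! ### Counting quantifiers and definability of infinite fibres -/

section Counting

variable {L : FirstOrder.Language.{u, v}} {M : Type w} [L.Structure M]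

theorem natCast_le_encard_iff {α : Type*} {s : Set α} {m : ℕ} :
    (m : ℕ∞) ≤ s.encard ↔ ∃ f : Fin m → α, (∀ i, f i ∈ s) ∧ Function.Injective f := by
  constructor
  · intro h
    obtain ⟨t, hts, ht⟩ := exists_subset_encard_eq h
    have htf : t.Finite := finite_of_encard_eq_coe ht
    have := htf.fintype
    have hc : Fintype.card t = m := by
      rw [← Nat.card_eq_fintype_card, Nat.card_coe_set_eq, Set.ncard, ht]; simp
    let e := (Fintype.equivFinOfCardEq hc).symm
    exact ⟨fun i => e i, fun i => hts (e i).2, Subtype.val_injective.comp e.injective⟩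
  · rintro ⟨f, hf, hinj⟩
    calc (m : ℕ∞) = (range f).encard := by
          rw [← image_univ, hinj.encard_image]; simp
      _ ≤ s.encard := encard_le_encard (range_subset_iff.2 hf)

/-- The formula saying that at least `m` values of the variable `y` satisfy `φ`. -/
noncomputable def countGe {α : Type*} [DecidableEq α] (φ : L.Formula α) (y : α) (m : ℕ) :
    L.Formula α :=
  Formula.iExs (Fin m)
    (Formula.iInf (fun i : Fin m =>
        φ.relabel (fun a => if a = y then (Sum.inr i : α ⊕ Fin m) else Sum.inl a)) ⊓
      Formula.iInf (fun p : {p : Fin m × Fin m // p.1 ≠ p.2} =>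
        ((Term.var (Sum.inr p.1.1 : α ⊕ Fin m)).equal (Term.var (Sum.inr p.1.2))).not))

theorem realize_countGe {α : Type*} [DecidableEq α] {φ : L.Formula α} {y : α} {m : ℕ}
    {x : α → M} : (countGe φ y m).Realize x ↔
      (m : ℕ∞) ≤ {t | φ.Realize (Function.update x y t)}.encard := by
  rw [natCast_le_encard_iff, countGe, Formula.realize_iExs]
  refine exists_congr fun f => ?_
  rw [Formula.realize_inf, Formula.realize_iInf, Formula.realize_iInf]
  refine and_congr (forall_congr' fun i => ?_) ?_
  · rw [Formula.realize_relabel, mem_ofPred_eq]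
    refine iff_of_eq (congrArg _ (funext fun a => ?_))
    by_cases h : a = y
    · subst h; simp
    · simp [h]
  · simp only [Formula.realize_not, Formula.realize_equal, Term.realize_var, Sum.elim_inr]
    constructor
    · intro h i j hij
      by_contra hne
      exact h ⟨(i, j), hne⟩ hij
    · intro h p hp
      exact p.2 (h hp)

theorem update_elim_inr {α β γ : Type*} [DecidableEq α] [DecidableEq β] (p : α → γ) (x : β → γ)
    (y : β) (t : γ) :
    Sum.elim p (Function.update x y t) = Function.update (Sum.elim p x) (Sum.inr y) t := by
  ext a
  rcases a with a | a
  · simp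
  · by_cases h : a = y
    · subst h; simp
    · simp [h]

theorem definable_countGe {A : Set M} {V : Type*} [DecidableEq V] {S : Set (V → M)}
    (hS : A.Definable L S) (y : V) (m : ℕ) :
    A.Definable L {x | (m : ℕ∞) ≤ {t | Function.update x y t ∈ S}.encard} := by
  classical
  obtain ⟨φ, rfl⟩ := definable_iff_exists_formula_sum.1 hS
  refine definable_iff_exists_formula_sum.2 ⟨countGe φ (Sum.inr y) m, ?_⟩
  ext x
  simp only [mem_ofPred_eq, realize_countGe, update_elim_inr]

theorem IsGeometric.exists_bound (hM : IsGeometric L M) {α : Type*} [DecidableEq α]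
    (φ : L.Formula α) (y : α) : ∃ k : ℕ, ∀ x : α → M,
      {t | φ.Realize (Function.update x y t)}.Infinite ∨
        {t | φ.Realize (Function.update x y t)}.encard ≤ k := by
  let F := φ.freeVarFinset.erase y
  let e := F.equivFin
  let g : φ.freeVarFinset → Fin (F.card + 1) := fun a =>
    if h : (a : α) = y then 0 else (e ⟨a, Finset.mem_erase.2 ⟨h, a.2⟩⟩).succ
  obtain ⟨k, hk⟩ := hM.uniform_finiteness F.card (φ.restrictFreeVar g)
  refine ⟨k, fun x => ?_⟩
  convert hk (fun i => x (e.symm i)) using 3 <;>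
  · ext t
    refine (BoundedFormula.realize_restrictFreeVar _ fun a => ?_).symm
    by_cases h : (a : α) = y
    · simp [g, h]
    · simp [g, h]

theorem IsGeometric.exists_bound_of_definable (hM : IsGeometric L M) {A : Set M} {V : Type*}
    [DecidableEq V] {S : Set (V → M)} (hS : A.Definable L S) (y : V) : ∃ k : ℕ, ∀ x : V → M,
      {t | Function.update x y t ∈ S}.Infinite ∨ {t | Function.update x y t ∈ S}.encard ≤ k := by
  classical
  obtain ⟨φ, rfl⟩ := definable_iff_exists_formula_sum.1 hS
  obtain ⟨k, hk⟩ := hM.exists_bound φ (Sum.inr y)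
  refine ⟨k, fun x => ?_⟩
  simpa only [mem_ofPred_eq, update_elim_inr] using hk (Sum.elim (↑) x)

/-- If k bounds all finite fibres, "infinite" means "at least k + 1 elements", which is first-order.
-/
theorem IsGeometric.definable_infinite (hM : IsGeometric L M) {A : Set M} {V : Type*}
    [DecidableEq V] {S : Set (V → M)} (hS : A.Definable L S) (y : V) :
    A.Definable L {x | {t | Function.update x y t ∈ S}.Infinite} := by
  obtain ⟨k, hk⟩ := hM.exists_bound_of_definable hS y
  convert definable_countGe hS y (k + 1) using 1
  ext x
  refine ⟨fun h => ?_, fun h => (hk x).resolve_right fun h' => ?_⟩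
  · simp only [mem_ofPred_eq] at h ⊢
    rw [h.encard_eq]; exact le_top
  · have := le_trans h h'
    rw [Nat.cast_le] at this
    omega

theorem definable₁_of_formula {β : Type*} {A : Set M} (φ : L.Formula (β ⊕ Fin 1)) (p : β → M)
    (hp : ∀ b, p b ∈ A) : A.Definable₁ L {t | φ.Realize (Sum.elim p fun _ => t)} := by
  refine definable_iff_exists_formula_sum.2
    ⟨φ.relabel (Sum.map (fun b => (⟨p b, hp b⟩ : A)) id), ?_⟩
  ext x
  simp only [mem_ofPred_eq, Formula.realize_relabel]
  refine iff_of_eq (congrArg _ (funext fun a => ?_))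
  rcases a with a | a
  · rfl
  · simp [Subsingleton.elim a 0]

end Counting

/-! ### Curves are the definable thin sets -/

section Thin

/-- The possible values of the `j`-th coordinate of a point of `S` with `i`-th coordinate `a`. -/
def fibre {M V : Type*} (S : Set (V → M)) (i j : V) (a : M) : Set M :=
  {b | ∃ x ∈ S, x i = a ∧ x j = b}

theorem fibre_mono {M V : Type*} {S T : Set (V → M)} (h : S ⊆ T) (i j : V) (a : M) :
    fibre S i j a ⊆ fibre T i j a := fun _ ⟨x, hx, h'⟩ => ⟨x, h hx, h'⟩

/-- For any two distinct coordinates in `J`, all but finitely many values of the first one leave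
finitely many possibilities for the second one. -/
def ThinOn {M V : Type*} (J : Set V) (S : Set (V → M)) : Prop :=
  ∀ i ∈ J, ∀ j ∈ J, i ≠ j → {a | (fibre S i j a).Infinite}.Finite

variable {L : FirstOrder.Language.{u, v}} {M : Type w} [L.Structure M]

theorem update_elim_fin_one {β γ : Type*} [DecidableEq β] (p : β → γ) (x : Fin 1 → γ) (t : γ) :
    Function.update (Sum.elim p x) (Sum.inr 0) t = Sum.elim p fun _ => t := by
  rw [← update_elim_inr]
  congr 1
  ext a
  simp [Subsingleton.elim a 0]

theorem update_elim_pair_zero {β γ : Type*} [DecidableEq β] (p : β → γ) (x : Fin 2 → γ) (t : γ) :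
    Function.update (Sum.elim p x) (Sum.inr 0) t = Sum.elim p ![t, x 1] := by
  rw [← update_elim_inr]
  congr 1
  ext a
  fin_cases a <;> rfl

theorem update_elim_pair_one {β γ : Type*} [DecidableEq β] (p : β → γ) (x : Fin 2 → γ) (t : γ) :
    Function.update (Sum.elim p x) (Sum.inr 1) t = Sum.elim p ![x 0, t] := by
  rw [← update_elim_inr]
  congr 1
  ext a
  fin_cases a <;> rfl

/-- The pairs of `i`-th and `j`-th coordinates of points of `S`. -/
theorem definable_pairs {A : Set M} {V : Type*} [Finite V] {S : Set (V → M)}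
    (hS : A.Definable L S) (i j : V) :
    A.Definable L {z : Fin 2 → M | z 1 ∈ fibre S i j (z 0)} := by
  convert hS.image_comp ![i, j] using 1
  ext z
  constructor
  · rintro ⟨x, hx, h0, h1⟩
    refine ⟨x, hx, ?_⟩
    ext k
    fin_cases k
    · exact h0
    · exact h1
  · rintro ⟨x, hx, rfl⟩
    exact ⟨x, hx, rfl, rfl⟩

theorem IsGeometric.definable₁_infinite_fibre (hM : IsGeometric L M) {A : Set M} {V : Type*}
    [Finite V] {S : Set (V → M)} (hS : A.Definable L S) (i j : V) :
    A.Definable₁ L {a | (fibre S i j a).Infinite} :=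
  (hM.definable_infinite (definable_pairs hS i j) 1).preimage_comp (fun _ => (0 : Fin 1))

theorem realize_of_forall {N : Type*} [L.Structure N] (f : M ↪ₑ[L] N) {B : Set M} {ι : Type*}
    [Finite ι] {ψ : L.Formula (B ⊕ ι)}
    (h : ∀ x : ι → M, ψ.Realize (Sum.elim (fun b : B => (b : M)) x)) (a : ι → N) :
    ψ.Realize (Sum.elim (fun b : B => f b) a) := by
  have h1 : (ψ.iAlls ι).Realize (fun b : B => (b : M)) := Formula.realize_iAlls.2 h
  have h2 := (f.map_formula (ψ.iAlls ι) _).2 h1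
  exact Formula.realize_iAlls.1 h2 a

/-- Thinness transfers to N as two numerical bounds. Either the i-th coordinate is one of boundedly
many exceptional values, hence algebraic over B, or the j-th coordinate lies in a bounded fibre over
it. Both contradict independence. -/
theorem IsGeometric.aclDim_le_one (hM : IsGeometric L M) {B : Set M} {n : ℕ}
    {φ : L.Formula (B ⊕ Fin n)}
    (h : ThinOn univ {x : Fin n → M | φ.Realize (Sum.elim (fun b : B => (b : M)) x)}) :
    aclDim L φ ≤ 1 := by
  classical
  refine iSup_le ?_
  rintro ⟨d, N, _, f, a, e, ha, he⟩
  by_contra hd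
  have hd2 : 2 ≤ d := by
    by_contra hlt
    refine hd ?_
    have : d ≤ 1 := by omega
    exact_mod_cast this
  set i := e ⟨0, by omega⟩ with hi
  set j := e ⟨1, by omega⟩ with hj
  have hij : i ≠ j := by
    intro h
    have := e.injective h
    simp at this
  set S := {x : Fin n → M | φ.Realize (Sum.elim (fun b : B => (b : M)) x)} with hS
  have hdef : B.Definable L S := definable_iff_exists_formula_sum.2 ⟨φ, rfl⟩
  obtain ⟨χ, hχ⟩ := definable_iff_exists_formula_sum.1 (definable_pairs hdef i j)
  have hχ' : ∀ z : Fin 2 → M, χ.Realize (Sum.elim (fun b : B => (b : M)) z) ↔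
      z 1 ∈ fibre S i j (z 0) := fun z => (Set.ext_iff.1 hχ z).symm
  obtain ⟨k, hk⟩ := hM.exists_bound χ (Sum.inr 1)
  -- In M, more than k values means infinitely many, so Q confines the first variable to the finite
  -- set E.
  let Q : L.Formula (B ⊕ Fin 2) := countGe χ (Sum.inr 1) (k + 1)
  have hfin := h i trivial j trivial hij
  set E := {a | (fibre S i j a).Infinite} with hE
  have hQ : ∀ z : Fin 2 → M, Q.Realize (Sum.elim (fun b : B => (b : M)) z) → z 0 ∈ E := by
    intro z hz
    have h1 := realize_countGe.1 hz
    have h2 := (hk (Sum.elim (fun b : B => (b : M)) z)).resolve_right fun h' => by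
      have := le_trans h1 h'
      rw [Nat.cast_le] at this
      omega
    simp only [update_elim_pair_one, hχ'] at h2
    exact h2
  have hQE : ∀ z : Fin 2 → M, ¬ (countGe Q (Sum.inr 0) (E.ncard + 1)).Realize
      (Sum.elim (fun b : B => (b : M)) z) := by
    intro z hz
    have h1 := realize_countGe.1 hz
    have h2 : {t | Q.Realize (Function.update (Sum.elim (fun b : B => (b : M)) z) (Sum.inr 0) t)}
        ⊆ E := by
      intro t ht
      rw [mem_ofPred_eq, update_elim_pair_zero] at ht
      exact hQ _ ht
    have h3 := le_trans h1 (encard_le_encard h2)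
    rw [← hfin.cast_ncard_eq, Nat.cast_le] at h3
    omega
  have hNχ : χ.Realize (Sum.elim (fun b : B => f b) ![a i, a j]) := by
    have := realize_of_forall f (ψ := φ.imp (χ.relabel (Sum.map id ![i, j]))) (fun x => by
      rw [Formula.realize_imp, Formula.realize_relabel]
      intro hx
      have : Sum.elim (fun b : B => (b : M)) x ∘ Sum.map id ![i, j] =
          Sum.elim (fun b : B => (b : M)) ![x i, x j] := by
        ext c
        rcases c with c | c
        · rfl
        · fin_cases c <;> rfl
      rw [this, hχ']
      exact ⟨x, hx, rfl, rfl⟩) a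
    rw [Formula.realize_imp, Formula.realize_relabel] at this
    convert this ha using 1
    ext c
    rcases c with c | c
    · rfl
    · fin_cases c <;> rfl
  have hNQ : ∀ z : Fin 2 → N, ¬ (countGe Q (Sum.inr 0) (E.ncard + 1)).Realize
      (Sum.elim (fun b : B => f b) z) := fun z => by
    have := realize_of_forall f (ψ := (countGe Q (Sum.inr 0) (E.ncard + 1)).not)
      (fun x => by rw [Formula.realize_not]; exact hQE x) z
    rwa [Formula.realize_not] at this
  have finite_of_lt : ∀ (s : Set N) (m : ℕ), ¬ ((m : ℕ∞) ≤ s.encard) → s.Finite := by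
    intro s m hs
    by_contra hinf
    exact hs (by rw [(show s.Infinite from hinf).encard_eq]; exact le_top)
  by_cases hai : Q.Realize (Sum.elim (fun b : B => f b) ![a i, a j])
  · refine he ⟨0, by omega⟩ ⟨{t | Q.Realize (Sum.elim (fun b : B => f b) ![t, a j])}, ?_, ?_, hai⟩
    · convert definable₁_of_formula (Q.relabel (Sum.map id (fun _ => 0)))
        (fun b : B => f b) (A := _ ∪ f '' B) (fun b => Or.inr ⟨b, b.2, rfl⟩) using 1
      ext t
      simp only [mem_ofPred_eq, Formula.realize_relabel, Q, realize_countGe]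
      have : Sum.elim (fun b : B => f b) (fun _ => t) ∘ Sum.map id (fun _ : Fin 2 => (0 : Fin 1)) =
          Sum.elim (fun b : B => f b) ![t, t] := by
        ext c
        rcases c with c | c
        · rfl
        · fin_cases c <;> rfl
      rw [this]
      simp only [update_elim_pair_one, Matrix.cons_val_zero]
    · have := hNQ ![a i, a j]
      rw [realize_countGe] at this
      simp only [update_elim_pair_zero] at this
      exact finite_of_lt _ _ this
  · refine he ⟨1, by omega⟩ ⟨{t | χ.Realize (Sum.elim (fun b : B => f b) ![a i, t])}, ?_, ?_, hNχ⟩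
    · convert definable₁_of_formula
        (χ.relabel (Sum.elim (fun b => Sum.inl (Sum.inl b))
          ![Sum.inl (Sum.inr ()), Sum.inr 0] : B ⊕ Fin 2 → (B ⊕ Unit) ⊕ Fin 1))
        (Sum.elim (fun b : B => f b) (fun _ => a i)) ?_ using 1
      · ext t
        simp only [mem_ofPred_eq, Formula.realize_relabel]
        refine iff_of_eq (congrArg _ (funext fun c => ?_))
        rcases c with c | c
        · rfl
        · fin_cases c <;> rfl
      · rintro (b | b)
        · exact Or.inr ⟨b, b.2, rfl⟩
        · exact Or.inl ⟨⟨0, by omega⟩, by simp, rfl⟩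
    · rw [realize_countGe] at hai
      simp only [update_elim_pair_one] at hai
      exact finite_of_lt _ _ hai

/-- The element of an ultrapower represented by a family of elements. -/
def germ {α : Type*} (U : Ultrafilter α) (r : α → M) : (U : Filter α).Product fun _ => M :=
  Quotient.mk _ r

theorem realize_germ {α β : Type*} {U : Ultrafilter α} [Nonempty M] (φ : L.Formula β)
    (x : β → α → M) :
    (φ.Realize fun i => germ U (x i)) ↔ ∀ᶠ a in (U : Filter α), φ.Realize fun i => x i a :=
  Ultraproduct.realize_formula_cast (u := U) (M := fun _ => M) φ x

open Filter in
-- The map ρ records what the parameters may depend on. By Łoś, an algebraic formula satisfied by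
-- the germ of r has, at almost every index, finitely many solutions determined by ρ, and r avoids
-- any such family of finite sets.
theorem ultraproduct_notMem_acl {α T : Type*} {U : Ultrafilter α} [Nonempty M]
    {A : Set ((U : Filter α).Product fun _ => M)} {ρ : α → T} {r : α → M}
    (hA : ∀ p ∈ A, ∃ g : T → M, p = germ U fun x => g (ρ x))
    (hr : ∀ G : T → Set M, (∀ t, (G t).Finite) → ∀ᶠ x in U, r x ∉ G (ρ x)) :
    germ U r ∉ acl L A := by
  classical
  rintro ⟨S, hS, hfin, hrS⟩
  obtain ⟨θ, hθ⟩ := definable_iff_exists_formula_sum.1 hS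
  have hθ' : ∀ t, θ.Realize (Sum.elim (fun p : A => (p : (U : Filter α).Product fun _ => M))
      fun _ => t) ↔ t ∈ S := fun t => (Set.ext_iff.1 hθ fun _ => t).symm
  choose! g hg using hA
  let y : A ⊕ Fin 1 → α → M := Sum.elim (fun p x => g p (ρ x)) fun _ => r
  have hy : (Sum.elim (fun p : A => (p : (U : Filter α).Product fun _ => M))
      fun _ => germ U r) =
      fun c => germ U (y c) := by
    ext c
    rcases c with c | c
    · exact hg _ c.2
    · rfl
  have h1 := (hθ' _).2 hrS
  rw [hy, realize_germ] at h1
  have h2 : ¬ (countGe θ (Sum.inr 0) (S.ncard + 1)).Realize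
      (Sum.elim (fun p : A => (p : (U : Filter α).Product fun _ => M))
        fun _ => germ U r) := by
    rw [realize_countGe]
    simp only [update_elim_fin_one, hθ', ofPred_mem_eq]
    rw [← hfin.cast_ncard_eq, Nat.cast_le]
    omega
  rw [← Formula.realize_not, hy, realize_germ] at h2
  let F : T → Set M := fun t =>
    {s | θ.Realize (Sum.elim (fun p : A => g p t) fun _ => s)}
  -- Infinite solution sets are replaced by ∅ to get finite sets at every t; by `h2` this changes
  -- nothing at almost every index.
  have h3 := hr (fun t => {s ∈ F t | (F t).Finite}) (fun t => by
    by_cases h : (F t).Finite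
    · exact h.subset fun s hs => hs.1
    · convert finite_empty
      ext s
      simp [h])
  obtain ⟨x, ⟨hx1, hx2⟩, hx3⟩ := ((h1.and h2).and h3).exists
  have hyx : (fun c => y c x) = Sum.elim (fun p : A => g p (ρ x)) fun _ => r x := by
    ext c
    rcases c with c | c <;> rfl
  rw [hyx] at hx1 hx2
  refine hx3 ⟨hx1, ?_⟩
  rw [Formula.realize_not, realize_countGe] at hx2
  simp only [update_elim_fin_one] at hx2
  by_contra hinf
  exact hx2 (by
    rw [(show {s | θ.Realize (Sum.elim (fun p : A => g p (ρ x)) fun _ => s)}.Infinite from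
      hinf).encard_eq]
    exact le_top)

/-- The diagonal embedding of a structure in an ultrapower. -/
noncomputable def ultrapowerEmbedding (L : FirstOrder.Language.{u, v}) {M : Type w} [L.Structure M]
    [Nonempty M] {α : Type*} (U : Ultrafilter α) :
    M ↪ₑ[L] (U : Filter α).Product fun _ => M where
  toFun m := germ U fun _ => m
  map_formula' := fun n φ x => by
    have := realize_germ (U := U) φ (fun i _ => x i)
    rw [Filter.eventually_const] at this
    exact this

open Filter in
-- If infinitely many values had infinite fibres, an ultrapower indexed by the points themselves
-- would contain a point of the set whose coordinates i and j are independent over B.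
theorem thinOn_of_aclDim_le_one {B : Set M} {n : ℕ} {φ : L.Formula (B ⊕ Fin n)}
    (h : aclDim L φ ≤ 1) :
    ThinOn univ {x : Fin n → M | φ.Realize (Sum.elim (fun b : B => (b : M)) x)} := by
  intro i _ j _ hij
  by_contra hinf
  set S := {x : Fin n → M | φ.Realize (Sum.elim (fun b : B => (b : M)) x)} with hS
  change {a | (fibre S i j a).Infinite}.Infinite at hinf
  have : Nonempty M := ⟨hinf.nonempty.some⟩
  -- The lift puts the ultrapower in the universe over which `aclDim` ranges.
  let α := ULift.{max u v} (Fin n → M)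
  -- Along this filter the i-th coordinate avoids every finite set, and the j-th avoids every finite
  -- set depending on the i-th.
  let F : Filter α := comap (fun x : α => (x.down i, x.down j)) (curry cofinite cofinite) ⊓
    𝓟 {x | x.down ∈ S}
  have hF : F.NeBot := by
    rw [← frequently_mem_iff_neBot, frequently_comap, frequently_curry_iff]
    refine (frequently_cofinite_iff_infinite.2 hinf).mono fun a ha => ?_
    refine (frequently_cofinite_iff_infinite.2 ha).mono fun b hb => ?_
    obtain ⟨x, hx, rfl, rfl⟩ := hb
    exact ⟨⟨x⟩, rfl, hx⟩
  let U : Ultrafilter α := Ultrafilter.of F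
  have hUF : (U : Filter α) ≤ F := Ultrafilter.of_le F
  have hUS : ∀ᶠ x : α in U, x.down ∈ S := hUF (mem_inf_of_right (mem_principal_self _))
  have hUG : ∀ P : M × M → Prop, (∀ᶠ a in cofinite, ∀ᶠ b in cofinite, P (a, b)) →
      ∀ᶠ x : α in U, P (x.down i, x.down j) := by
    intro P hP
    exact hUF (mem_inf_of_left ((eventually_curry_iff.2 hP).comap fun x : α => (x.down i, x.down j)))
  let N := (U : Filter α).Product fun _ => M
  let f : M ↪ₑ[L] N := ultrapowerEmbedding L U
  let a : Fin n → N := fun k => germ U fun x : α => x.down k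
  let e : Fin 2 ↪ Fin n := ⟨![i, j], by
    intro c d hcd
    fin_cases c <;> fin_cases d <;> simp_all [hij.symm]⟩
  suffices hd : ((2 : ℕ) : WithBot ℕ∞) ≤ aclDim L φ by
    have h' : ((2 : ℕ) : WithBot ℕ∞) ≤ 1 := hd.trans h
    have : (2 : ℕ) ≤ 1 := by exact_mod_cast h'
    omega
  refine le_iSup_of_le ⟨2, N, inferInstance, f, a, e, ?_, ?_⟩ le_rfl
  · let y : B ⊕ Fin n → α → M := Sum.elim (fun b _ => b) fun k x => x.down k
    have hy : Sum.elim (fun b : B => f b) a = fun c => germ U (y c) := by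
      ext c
      rcases c with c | c <;> rfl
    rw [hy, realize_germ]
    refine hUS.mono fun x hx => ?_
    have hyx : (fun c => y c x) = Sum.elim (fun b : B => (b : M)) x.down := by
      ext c
      rcases c with c | c <;> rfl
    rw [hyx]
    exact hx
  · intro c
    fin_cases c
    · refine ultraproduct_notMem_acl (ρ := fun _ : α => ()) ?_ fun G hG => ?_
      · rintro p (⟨k, hk, -⟩ | ⟨b, -, rfl⟩)
        · exact absurd hk (Fin.not_lt_zero k)
        · exact ⟨fun _ => b, rfl⟩
      · refine hUG (fun p => p.1 ∉ G ()) ?_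
        filter_upwards [(hG ()).compl_mem_cofinite] with s hs
        exact Eventually.of_forall fun _ => hs
    · refine ultraproduct_notMem_acl (ρ := fun x : α => x.down i) ?_ fun G hG => ?_
      · rintro p (⟨k, hk, rfl⟩ | ⟨b, -, rfl⟩)
        · have : k = 0 := by
            have : (k : ℕ) < 1 := hk
            ext
            simp only [Fin.val_zero]
            omega
          subst this
          exact ⟨id, rfl⟩
        · exact ⟨fun _ => b, rfl⟩
      · refine hUG (fun p => p.2 ∉ G p.1) (Eventually.of_forall fun s => ?_)
        exact (hG s).compl_mem_cofinite

theorem IsGeometric.isCurve_iff (hM : IsGeometric L M) {B : Set M} {n : ℕ}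
    {C : Set (Fin n → M)} : IsCurve L B C ↔ B.Definable L C ∧ ThinOn univ C := by
  constructor
  · rintro ⟨φ, rfl, hφ⟩
    exact ⟨definable_iff_exists_formula_sum.2 ⟨φ, rfl⟩, thinOn_of_aclDim_le_one hφ⟩
  · rintro ⟨h, hthin⟩
    obtain ⟨φ, rfl⟩ := definable_iff_exists_formula_sum.1 h
    exact ⟨φ, rfl, hM.aclDim_le_one hthin⟩

end Thin

/-! ### Finite sets definable over an algebraic closure -/

section Acl

variable {L : FirstOrder.Language.{u, v}} {M : Type w} [L.Structure M]

/-- The parameters can be replaced by all their candidates in finite A-definable sets, provided only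
candidates with at most |S| solutions are kept. The union of the resulting solution sets is finite,
A-definable and contains S. -/
theorem subset_acl_of_definable {A S : Set M} (hS : (acl L A).Definable₁ L S) (hfin : S.Finite) :
    S ⊆ acl L A := by
  classical
  intro b hb
  obtain ⟨A0, hA0, hS0⟩ := definable_iff_finitely_definable.1 hS
  obtain ⟨θ, hθ⟩ := definable_iff_exists_formula_sum.1 hS0
  have hθ' : ∀ t, θ.Realize (Sum.elim (fun p : (A0 : Set M) => (p : M)) fun _ => t) ↔ t ∈ S :=
    fun t => (Set.ext_iff.1 hθ fun _ => t).symm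
  choose T hTdef hTfin hT using fun p : (A0 : Set M) => hA0 p.2
  let ψ := countGe θ (Sum.inr 0) (S.ncard + 1)
  have hdef : ∀ χ : L.Formula ((A0 : Set M) ⊕ Fin 1), A.Definable L {z | χ.Realize z} := fun χ =>
    (empty_definable_iff.2 ⟨χ, rfl⟩).mono (empty_subset A)
  let W : Set ((A0 : Set M) ⊕ Fin 1 → M) :=
    ((⋂ p, {z | z (Sum.inl p) ∈ T p}) ∩ {z | θ.Realize z}) ∩ {z | ψ.Realize z}ᶜ
  have hW : A.Definable L W :=
    ((definable_iInter_of_finite fun p =>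
      (hTdef p).preimage_comp (fun _ => (Sum.inl p : (A0 : Set M) ⊕ Fin 1))).inter
        (hdef θ)).inter (hdef ψ).compl
  refine ⟨{t | ∃ z ∈ W, z (Sum.inr 0) = t}, ?_, ?_, ?_⟩
  · change A.Definable L {x : Fin 1 → M | ∃ z ∈ W, z (Sum.inr 0) = x 0}
    convert hW.image_comp (Sum.inr : Fin 1 → (A0 : Set M) ⊕ Fin 1) using 1
    ext x
    refine exists_congr fun z => and_congr_right fun _ => ⟨fun h => ?_, fun h => congrFun h 0⟩
    ext c
    simpa [Subsingleton.elim c 0] using h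
  · have hpi : (Set.pi univ T).Finite := Finite.pi fun p => hTfin p
    refine Set.Finite.subset (s := ⋃ s ∈ {s ∈ Set.pi univ T |
      {t | θ.Realize (Sum.elim s fun _ => t)}.Finite}, {t | θ.Realize (Sum.elim s fun _ => t)})
      ((hpi.subset fun s hs => hs.1).biUnion fun s hs => hs.2) ?_
    rintro _ ⟨z, ⟨⟨hz1, hz2⟩, hz3⟩, rfl⟩
    have hz : z = Sum.elim (z ∘ Sum.inl) (fun _ => z (Sum.inr 0)) := by
      ext c
      rcases c with c | c
      · rfl
      · simp [Subsingleton.elim c 0]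
    refine mem_biUnion (x := z ∘ Sum.inl) ⟨fun p _ => mem_iInter.1 hz1 p, ?_⟩ ?_
    · by_contra hinf
      refine hz3 ?_
      rw [mem_ofPred_eq, hz, realize_countGe]
      simp only [update_elim_fin_one]
      rw [Set.Infinite.encard_eq hinf]
      exact le_top
    · rw [mem_ofPred_eq, ← hz]
      exact hz2
  · refine ⟨Sum.elim (↑) fun _ => b, ⟨⟨mem_iInter.2 hT, (hθ' b).2 hb⟩, fun h => ?_⟩, rfl⟩
    rw [mem_ofPred_eq, realize_countGe] at h
    simp only [update_elim_fin_one, hθ', ofPred_mem_eq] at h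
    rw [← hfin.cast_ncard_eq, Nat.cast_le] at h
    omega

end Acl

/-! ### Elimination of one variable -/

section Projection

variable (L : FirstOrder.Language.{u, v}) {M : Type w} [L.Structure M] (B : Set M)
  {V : Type*}

/-- A `B`-definable set which depends only on the coordinates in `J` and is thin in these. -/
structure IsThinCylinder (J : Finset V) (S : Set (V → M)) : Prop where
  definable : B.Definable L S
  dep : ∀ x x' : V → M, (∀ i ∈ J, x i = x' i) → x ∈ S → x' ∈ S
  thin : ThinOn (J : Set V) S

/-- A `B`-definable set which depends only on the coordinates in `J`, among them `y`, in which the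
value of the coordinate `y` leaves finitely many possibilities for every other coordinate in `J`
and conversely. -/
structure IsInteralgebraic (y : V) (J : Finset V) (S : Set (V → M)) : Prop where
  mem : y ∈ J
  definable : B.Definable L S
  dep : ∀ x x' : V → M, (∀ i ∈ J, x i = x' i) → x ∈ S → x' ∈ S
  finite_left : ∀ j ∈ J, j ≠ y → ∀ a, (fibre S y j a).Finite
  finite_right : ∀ j ∈ J, j ≠ y → ∀ a, (fibre S j y a).Finite

/-- The boolean algebra generated by the thin cylinders which do not involve the variable `y`. -/
def cylinderAlgebra (y : V) : BooleanSubalgebra (Set (V → M)) :=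
  BooleanSubalgebra.closure {S | ∃ J : Finset V, y ∉ J ∧ IsThinCylinder L B J S}

variable {L B}

theorem definable_coord {E : Set M} (hE : B.Definable₁ L E) (j : V) :
    B.Definable L {x : V → M | x j ∈ E} :=
  hE.preimage_comp fun _ => j

theorem IsThinCylinder.of_singleton {E : Set M} (hE : B.Definable₁ L E) (j : V) :
    IsThinCylinder L B {j} {x : V → M | x j ∈ E} where
  definable := definable_coord hE j
  dep x x' h hx := by
    rw [mem_ofPred_eq, ← h j (Finset.mem_singleton_self j)]
    exact hx
  thin i hi k hk hik := by
    simp only [Finset.coe_singleton, mem_singleton_iff] at hi hk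
    exact absurd (hi.trans hk.symm) hik

theorem IsInteralgebraic.of_singleton {y : V} {S : Set (V → M)} (hS : B.Definable L S)
    (dep : ∀ x x' : V → M, x y = x' y → x ∈ S → x' ∈ S) : IsInteralgebraic L B y {y} S where
  mem := Finset.mem_singleton_self y
  definable := hS
  dep x x' h := dep x x' (h y (Finset.mem_singleton_self y))
  finite_left _ hj hjy := absurd (Finset.mem_singleton.1 hj) hjy
  finite_right _ hj hjy := absurd (Finset.mem_singleton.1 hj) hjy

theorem IsInteralgebraic.univ {y : V} : IsInteralgebraic L B y {y} (univ : Set (V → M)) :=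
  .of_singleton definable_univ fun _ _ _ _ => trivial

variable [DecidableEq V] {y : V}

theorem definable_update {S : Set (V → M)} (hS : B.Definable L S) {e : M} (he : e ∈ B) (j : V) :
    B.Definable L {x | Function.update x j e ∈ S} := by
  convert definable_countGe
    (hS.inter (definable_coord (Definable.singleton_of_mem L he) j)) j 1 using 1
  ext x
  simp only [mem_ofPred_eq, Nat.cast_one, one_le_encard_iff_nonempty]
  constructor
  · intro h
    exact ⟨e, h, by simp⟩
  · rintro ⟨t, ht, hte⟩
    have : t = e := by simpa using hte
    rwa [this] at ht

theorem IsThinCylinder.update {J : Finset V} {S : Set (V → M)} (hS : IsThinCylinder L B J S)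
    {e : M} (he : e ∈ B) (j : V) :
    IsThinCylinder L B (J.erase j) {x | Function.update x j e ∈ S} where
  definable := definable_update hS.definable he j
  dep x x' h hx := by
    refine hS.dep _ _ (fun i hi => ?_) hx
    by_cases hij : i = j
    · subst hij; simp
    · simp [hij, h i (Finset.mem_erase.2 ⟨hij, hi⟩)]
  thin i hi k hk hik := by
    have hi' := Finset.mem_erase.1 (Finset.mem_coe.1 hi)
    have hk' := Finset.mem_erase.1 (Finset.mem_coe.1 hk)
    refine (hS.thin i hi'.2 k hk'.2 hik).subset fun a ha => Set.Infinite.mono ?_ ha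
    rintro b ⟨x, hx, rfl, rfl⟩
    exact ⟨_, hx, by simp [hi'.1], by simp [hk'.1]⟩

theorem IsInteralgebraic.inter {J J' : Finset V} {S S' : Set (V → M)}
    (h : IsInteralgebraic L B y J S) (h' : IsInteralgebraic L B y J' S') :
    IsInteralgebraic L B y (J ∪ J') (S ∩ S') where
  mem := Finset.mem_union_left _ h.mem
  definable := h.definable.inter h'.definable
  dep x x' hxx' hx := ⟨h.dep x x' (fun i hi => hxx' i (Finset.mem_union_left _ hi)) hx.1,
    h'.dep x x' (fun i hi => hxx' i (Finset.mem_union_right _ hi)) hx.2⟩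
  finite_left j hj hjy a := by
    rcases Finset.mem_union.1 hj with hj | hj
    · exact (h.finite_left j hj hjy a).subset (fibre_mono inter_subset_left _ _ _)
    · exact (h'.finite_left j hj hjy a).subset (fibre_mono inter_subset_right _ _ _)
  finite_right j hj hjy a := by
    rcases Finset.mem_union.1 hj with hj | hj
    · exact (h.finite_right j hj hjy a).subset (fibre_mono inter_subset_left _ _ _)
    · exact (h'.finite_right j hj hjy a).subset (fibre_mono inter_subset_right _ _ _)

/-- The values of the variable `y` which put `x` in `S`. -/
def slice (S : Set (V → M)) (y : V) (x : V → M) : Set M :=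
  {t | Function.update x y t ∈ S}

theorem slice_mono {S T : Set (V → M)} (h : S ⊆ T) (y : V) (x : V → M) :
    slice S y x ⊆ slice T y x := fun _ ht => h ht

theorem IsInteralgebraic.eq_singleton_or_finite {J : Finset V} {S : Set (V → M)}
    (h : IsInteralgebraic L B y J S) : J = {y} ∨ ∀ x, (slice S y x).Finite := by
  by_cases hJ : ∃ j ∈ J, j ≠ y
  · obtain ⟨j, hj, hjy⟩ := hJ
    refine Or.inr fun x => (h.finite_right j hj hjy (x j)).subset fun t ht => ?_
    exact ⟨_, ht, by simp [hjy], by simp⟩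
  · push Not at hJ
    exact Or.inl (Finset.eq_singleton_iff_unique_mem.2 ⟨h.mem, hJ⟩)

/-- A nonempty slice gives a witness t for y; one coordinate leaves finitely many t, and each t
leaves finitely many values of another coordinate. For m = 0 there is no witness, and thinness can
fail. -/
theorem IsInteralgebraic.isThinCylinder_count {J : Finset V} {S : Set (V → M)}
    (h : IsInteralgebraic L B y J S) {m : ℕ} (hm : 1 ≤ m) :
    IsThinCylinder L B (J.erase y) {x | (m : ℕ∞) ≤ (slice S y x).encard} where
  definable := definable_countGe h.definable y m
  dep x x' hxx' hx := by
    refine le_trans (show (m : ℕ∞) ≤ _ from hx)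
      (encard_le_encard fun t ht => h.dep _ _ (fun i hi => ?_) ht)
    by_cases hiy : i = y
    · subst hiy; simp
    · simp [hiy, hxx' i (Finset.mem_erase.2 ⟨hiy, hi⟩)]
  thin i hi k hk hik := by
    have hi' := Finset.mem_erase.1 (Finset.mem_coe.1 hi)
    have hk' := Finset.mem_erase.1 (Finset.mem_coe.1 hk)
    convert finite_empty
    refine eq_empty_iff_forall_notMem.2 fun a ha => ha ?_
    refine ((h.finite_right i hi'.2 hi'.1 a).biUnion fun c _ =>
      h.finite_left k hk'.2 hk'.1 c).subset ?_
    rintro b ⟨x, hx, rfl, rfl⟩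
    have h1 : (1 : ℕ∞) ≤ (slice S y x).encard := le_trans (by exact_mod_cast hm) hx
    obtain ⟨t, ht⟩ := one_le_encard_iff_nonempty.1 h1
    exact mem_biUnion (x := t) ⟨_, ht, by simp [hi'.1], by simp⟩
      ⟨_, ht, by simp, by simp [hk'.1]⟩

theorem biUnion_mem_of_finite {α ι : Type*} (𝒜 : BooleanSubalgebra (Set α)) {E : Set ι}
    (hE : E.Finite) {f : ι → Set α} (hf : ∀ i ∈ E, f i ∈ 𝒜) : (⋃ i ∈ E, f i) ∈ 𝒜 := by
  induction E, hE using Set.Finite.induction_on with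
  | empty => simpa using 𝒜.bot_mem
  | insert _ _ ih =>
    rw [biUnion_insert]
    exact BooleanSubalgebra.sup_mem (hf _ (mem_insert _ _)) (ih fun i hi => hf i (mem_insert_of_mem _ hi))

/-- The complement of the union of a list of sets. -/
def avoid {α : Type*} (l : List (Set α)) : Set α :=
  {x | ∀ N ∈ l, x ∉ N}

/-- Inclusion-exclusion, one set at a time: passing from l to N :: l removes from the slice of P ∩
avoid l exactly that of P ∩ N ∩ avoid l, and P ∩ N is again interalgebraic. The bound k on the
slices of P makes the union over the possible sizes s finite. -/
theorem mem_cylinderAlgebra_of_count (hM : IsGeometric L M) {l : List (Set (V → M))}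
    (hl : ∀ N ∈ l, ∃ J, IsInteralgebraic L B y J N) {J : Finset V} {P : Set (V → M)}
    (hP : IsInteralgebraic L B y J P) (hfin : ∀ x, (slice P y x).Finite) (t : ℕ) :
    {x | (slice (P ∩ avoid l) y x).ncard = t} ∈ cylinderAlgebra L B y := by
  induction l generalizing J P t with
  | nil =>
    have hge : ∀ m : ℕ, {x | (m : ℕ∞) ≤ (slice P y x).encard} ∈ cylinderAlgebra L B y := by
      intro m
      rcases Nat.eq_zero_or_pos m with rfl | hm
      · convert (BooleanSubalgebra.top_mem (L := cylinderAlgebra L B y)) using 1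
        ext x
        simp
      · exact BooleanSubalgebra.subset_closure
          ⟨_, Finset.notMem_erase y J, hP.isThinCylinder_count hm⟩
    convert BooleanSubalgebra.inf_mem (hge t)
      (BooleanSubalgebra.compl_mem (hge (t + 1))) using 1
    ext x
    have h1 : P ∩ avoid [] = P := by ext; simp [avoid]
    simp only [h1, mem_ofPred_eq, inf_eq_inter, mem_inter_iff, mem_compl_iff,
      ← (hfin x).cast_ncard_eq, Nat.cast_le]
    omega
  | cons N l ih =>
    obtain ⟨J', hN⟩ := hl N List.mem_cons_self
    have hl' : ∀ N ∈ l, ∃ J, IsInteralgebraic L B y J N :=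
      fun N' hN' => hl N' (List.mem_cons_of_mem _ hN')
    obtain ⟨k, hk⟩ := hM.exists_bound_of_definable hP.definable y
    have hPN : ∀ x, (slice (P ∩ N) y x).Finite :=
      fun x => (hfin x).subset (slice_mono inter_subset_left y x)
    convert biUnion_mem_of_finite (cylinderAlgebra L B y) (finite_Iic k)
      (f := fun s => {x | (slice (P ∩ avoid l) y x).ncard = s + t} ∩
        {x | (slice (P ∩ N ∩ avoid l) y x).ncard = s})
      (fun s _ => BooleanSubalgebra.inf_mem (ih hl' hP hfin (s + t))
        (ih hl' (hP.inter hN) hPN s)) using 1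
    ext x
    have hA : (slice (P ∩ avoid l) y x).Finite :=
      (hfin x).subset (slice_mono inter_subset_left y x)
    have hB : (slice (P ∩ N ∩ avoid l) y x).Finite :=
      (hPN x).subset (slice_mono inter_subset_left y x)
    have hBA : slice (P ∩ N ∩ avoid l) y x ⊆ slice (P ∩ avoid l) y x :=
      slice_mono (inter_subset_inter_left _ inter_subset_left) y x
    have hdiff : slice (P ∩ avoid (N :: l)) y x =
        slice (P ∩ avoid l) y x \ slice (P ∩ N ∩ avoid l) y x := by
      ext s
      simp only [slice, avoid, List.mem_cons, forall_eq_or_imp, mem_ofPred_eq, mem_inter_iff,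
        mem_sdiff]
      tauto
    have hBk : (slice (P ∩ N ∩ avoid l) y x).ncard ≤ k := by
      have h1 : (slice P y x).encard ≤ k := (hk x).resolve_left fun h => h (hfin x)
      have h2 := le_trans (encard_le_encard
        (slice_mono (inter_subset_left.trans inter_subset_left :
          P ∩ N ∩ avoid l ⊆ P) y x)) h1
      rwa [← hB.cast_ncard_eq, Nat.cast_le] at h2
    have hle := ncard_le_ncard hBA hA
    simp only [hdiff, mem_ofPred_eq, ncard_sdiff hBA hB, mem_iUnion, mem_Iic, mem_inter_iff,
      exists_prop]
    constructor
    · intro h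
      exact ⟨_, hBk, by omega, rfl⟩
    · rintro ⟨s, -, h1, h2⟩
      omega

theorem update_mem_iff_of_mem_cylinderAlgebra {G : Set (V → M)} (hG : G ∈ cylinderAlgebra L B y)
    (x : V → M) (t : M) : Function.update x y t ∈ G ↔ x ∈ G := by
  induction hG using BooleanSubalgebra.closure_bot_sup_induction with
  | mem S hS =>
    obtain ⟨J, hyJ, hS⟩ := hS
    have h : ∀ i ∈ J, Function.update x y t i = x i := fun i hi =>
      Function.update_of_ne (fun h => hyJ (by rwa [h] at hi)) _ _
    exact ⟨hS.dep _ _ h, hS.dep _ _ fun i hi => (h i hi).symm⟩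
  | bot => rfl
  | sup S _ T _ hS hT => exact or_congr hS hT
  | compl S _ hS => exact not_congr hS

variable (L B y) in
/-- The sets in a normal form for the elimination of the variable `y`. -/
def basicSets : Set (Set (V → M)) :=
  {S | ∃ G ∈ cylinderAlgebra L B y, ∃ (J : Finset V) (P : Set (V → M)) (l : List (Set (V → M))),
    IsInteralgebraic L B y J P ∧
    (∀ N ∈ l, (∃ J, IsInteralgebraic L B y J N) ∧ ∀ x, (slice N y x).Finite) ∧
    S = G ∩ (P ∩ avoid l)}

theorem mem_basicSets_of_mem_cylinderAlgebra {G : Set (V → M)} (hG : G ∈ cylinderAlgebra L B y) :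
    G ∈ basicSets L B y :=
  ⟨G, hG, {y}, Set.univ, [], .univ, by simp, by ext; simp [avoid]⟩

theorem IsInteralgebraic.mem_basicSets {J : Finset V} {P : Set (V → M)}
    (hP : IsInteralgebraic L B y J P) : P ∈ basicSets L B y :=
  ⟨_, BooleanSubalgebra.top_mem, J, P, [], hP, by simp, by ext; simp [avoid]⟩

/-- If only y is involved, the complement also involves only y. Otherwise the slices are finite, so
P may serve as an avoided set. -/
theorem IsInteralgebraic.compl_mem_basicSets {J : Finset V} {P : Set (V → M)}
    (hP : IsInteralgebraic L B y J P) : Pᶜ ∈ basicSets L B y := by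
  rcases hP.eq_singleton_or_finite with rfl | hfin
  · refine (IsInteralgebraic.of_singleton hP.definable.compl fun x x' h hx hx' => hx ?_).mem_basicSets
    refine hP.dep x' x (fun i hi => ?_) hx'
    rw [Finset.mem_singleton.1 hi, h]
  · refine ⟨_, BooleanSubalgebra.top_mem, {y}, Set.univ, [P], .univ, ?_, by ext; simp [avoid]⟩
    simp only [List.mem_singleton, forall_eq]
    exact ⟨⟨J, hP⟩, hfin⟩

theorem infClosed_basicSets : InfClosed (basicSets L B y : Set (Set (V → M))) := by
  rintro _ ⟨G, hG, J, P, l, hP, hl, rfl⟩ _ ⟨G', hG', J', P', l', hP', hl', rfl⟩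
  refine ⟨_, BooleanSubalgebra.inf_mem hG hG', _, _, l ++ l', hP.inter hP', ?_, ?_⟩
  · intro N hN
    rcases List.mem_append.1 hN with h | h
    · exact hl N h
    · exact hl' N h
  · ext x
    simp only [avoid, inf_eq_inter, mem_inter_iff, mem_ofPred_eq, List.mem_append]
    constructor
    · rintro ⟨⟨h1, h2, h3⟩, h4, h5, h6⟩
      exact ⟨⟨h1, h4⟩, ⟨h2, h5⟩, fun N hN => hN.elim (h3 N) (h6 N)⟩
    · rintro ⟨⟨h1, h4⟩, ⟨h2, h5⟩, h⟩
      exact ⟨⟨h1, h2, fun N hN => h N (Or.inl hN)⟩, h4, h5, fun N hN => h N (Or.inr hN)⟩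

theorem compl_mem_supClosure_of_mem_basicSets {S : Set (V → M)} (hS : S ∈ basicSets L B y) :
    Sᶜ ∈ supClosure (basicSets L B y) := by
  obtain ⟨G, hG, J, P, l, hP, hl, rfl⟩ := hS
  have havoid : (avoid l)ᶜ ∈ supClosure (basicSets L B y) := by
    induction l with
    | nil =>
      convert subset_supClosure (mem_basicSets_of_mem_cylinderAlgebra
        (BooleanSubalgebra.bot_mem (L := cylinderAlgebra L B y))) using 1
      ext x
      simp [avoid]
    | cons N l ih =>
      obtain ⟨J', hN⟩ := (hl N List.mem_cons_self).1
      convert supClosed_supClosure (subset_supClosure hN.mem_basicSets)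
        (ih fun N' hN' => hl N' (List.mem_cons_of_mem _ hN')) using 1
      ext x
      simp only [avoid, List.mem_cons, forall_eq_or_imp, mem_compl_iff, mem_ofPred_eq, sup_eq_union,
        mem_union]
      tauto
  rw [compl_inter, compl_inter]
  exact supClosed_supClosure (subset_supClosure (mem_basicSets_of_mem_cylinderAlgebra
      (BooleanSubalgebra.compl_mem hG)))
    (supClosed_supClosure (subset_supClosure hP.compl_mem_basicSets) havoid)

variable (L B y) in
/-- The boolean algebra of the finite unions of sets in normal form. -/
def normalAlgebra : BooleanSubalgebra (Set (V → M)) where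
  carrier := supClosure (basicSets L B y)
  supClosed' := supClosed_supClosure
  infClosed' := infClosed_basicSets.supClosure
  bot_mem' := subset_supClosure (mem_basicSets_of_mem_cylinderAlgebra BooleanSubalgebra.bot_mem)
  compl_mem' {S} hS := by
    obtain ⟨t, ht, hts, rfl⟩ := hS
    refine Finset.sup'_induction (p := fun S => Sᶜ ∈ supClosure (basicSets L B y)) ht id ?_ ?_
    · intro S hS T hT
      rw [compl_sup]
      exact infClosed_basicSets.supClosure hS hT
    · exact fun S hS => compl_mem_supClosure_of_mem_basicSets (hts hS)

theorem mem_normalAlgebra_of_mem_basicSets {S : Set (V → M)} (hS : S ∈ basicSets L B y) :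
    S ∈ normalAlgebra L B y :=
  subset_supClosure hS

/-- The part of S with an exceptional value in y or opposite y is handled by substituting that
value, which lies in B by `hB`, and by induction on the number of coordinates. The rest of S is
interalgebraic. -/
theorem IsThinCylinder.mem_normalAlgebra [Finite V] (hM : IsGeometric L M)
    (hB : ∀ E : Set M, B.Definable₁ L E → E.Finite → E ⊆ B) {J : Finset V} {S : Set (V → M)}
    (hS : IsThinCylinder L B J S) : S ∈ normalAlgebra L B y := by
  induction hn : J.card using Nat.strong_induction_on generalizing J S with
  | _ n ih =>
  by_cases hyJ : y ∉ J
  · exact mem_normalAlgebra_of_mem_basicSets (mem_basicSets_of_mem_cylinderAlgebra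
      (BooleanSubalgebra.subset_closure ⟨J, hyJ, hS⟩))
  rw [not_not] at hyJ
  have hval : ∀ j ∈ J, ∀ e ∈ B, S ∩ {x | x j = e} ∈ normalAlgebra L B y := by
    intro j hj e he
    have h1 : {x : V → M | x j ∈ ({e} : Set M)} ∈ normalAlgebra L B y := by
      have hdef := Definable.singleton_of_mem L he
      refine mem_normalAlgebra_of_mem_basicSets ?_
      by_cases hjy : j = y
      · subst hjy
        refine (IsInteralgebraic.of_singleton (definable_coord hdef j)
          fun x x' h hx => ?_).mem_basicSets
        rw [mem_ofPred_eq, ← h]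
        exact hx
      · exact mem_basicSets_of_mem_cylinderAlgebra (BooleanSubalgebra.subset_closure
          ⟨{j}, by simpa using Ne.symm hjy, .of_singleton hdef j⟩)
    have h2 : {x | Function.update x j e ∈ S} ∈ normalAlgebra L B y :=
      ih _ (hn ▸ Finset.card_erase_lt_of_mem hj) (hS.update he j) rfl
    convert BooleanSubalgebra.inf_mem h2 h1 using 1
    ext x
    simp only [mem_inter_iff, mem_ofPred_eq, mem_singleton_iff, inf_eq_inter]
    refine and_congr_left ?_
    rintro rfl
    rw [Function.update_eq_self]
  let I : Set V := {j ∈ (J : Set V) | j ≠ y}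
  have hI : I.Finite := J.finite_toSet.subset fun j hj => hj.1
  let E : V → Set M := fun j => {a | (fibre S y j a).Infinite}
  let E' : V → Set M := fun j => {a | (fibre S j y a).Infinite}
  have hE : ∀ j ∈ I, (E j).Finite := fun j hj => hS.thin y hyJ j hj.1 (Ne.symm hj.2)
  have hE' : ∀ j ∈ I, (E' j).Finite := fun j hj => hS.thin j hj.1 y hyJ hj.2
  have hEd : ∀ j, B.Definable₁ L (E j) := fun j => hM.definable₁_infinite_fibre hS.definable y j
  have hEd' : ∀ j, B.Definable₁ L (E' j) := fun j => hM.definable₁_infinite_fibre hS.definable j y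
  -- Only the pairs containing y matter: X collects the points with an exceptional value in one of
  -- these pairs, in either direction.
  let X : Set (V → M) := ⋃ j ∈ I, ({x | x y ∈ E j} ∪ {x | x j ∈ E' j})
  have hX : B.Definable L X := by
    have := definable_biUnion_finset (A := B) (L := L)
      (fun j => (definable_coord (hEd j) y).union (definable_coord (hEd' j) j)) hI.toFinset
    simpa [X] using this
  have hSX : S ∩ X ∈ normalAlgebra L B y := by
    convert biUnion_mem_of_finite (normalAlgebra L B y) hI
      (f := fun j => (⋃ e ∈ E j, S ∩ {x | x y = e}) ∪ ⋃ e ∈ E' j, S ∩ {x | x j = e})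
      (fun j hj => BooleanSubalgebra.sup_mem
        (biUnion_mem_of_finite _ (hE j hj) fun e he =>
          hval y hyJ e (hB _ (hEd j) (hE j hj) he))
        (biUnion_mem_of_finite _ (hE' j hj) fun e he =>
          hval j hj.1 e (hB _ (hEd' j) (hE' j hj) he))) using 1
    ext x
    simp only [X, mem_inter_iff, mem_iUnion, mem_union, mem_ofPred_eq, exists_prop]
    constructor
    · rintro ⟨hx, j, hj, h | h⟩
      · exact ⟨j, hj, Or.inl ⟨_, h, hx, rfl⟩⟩
      · exact ⟨j, hj, Or.inr ⟨_, h, hx, rfl⟩⟩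
    · rintro ⟨j, hj, ⟨_, h, hx, rfl⟩ | ⟨_, h, hx, rfl⟩⟩
      · exact ⟨hx, j, hj, Or.inl h⟩
      · exact ⟨hx, j, hj, Or.inr h⟩
  have hSX' : IsInteralgebraic L B y J (S \ X) :=
    { mem := hyJ
      definable := hS.definable.sdiff hX
      dep := fun x x' h hx => by
        refine ⟨hS.dep x x' h hx.1, fun hx' => hx.2 ?_⟩
        simp only [X, mem_iUnion, mem_union, mem_ofPred_eq, exists_prop] at hx' ⊢
        obtain ⟨j, hj, hx'⟩ := hx'
        rw [← h y hyJ, ← h j hj.1] at hx'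
        exact ⟨j, hj, hx'⟩
      finite_left := fun j hj hjy a => by
        by_cases ha : a ∈ E j
        · convert finite_empty
          refine eq_empty_iff_forall_notMem.2 ?_
          rintro b ⟨x, hx, rfl, -⟩
          exact hx.2 (mem_biUnion (show j ∈ I from ⟨hj, hjy⟩) (Or.inl ha))
        · exact (not_infinite.1 ha).subset (fibre_mono sdiff_subset _ _ _)
      finite_right := fun j hj hjy a => by
        by_cases ha : a ∈ E' j
        · convert finite_empty
          refine eq_empty_iff_forall_notMem.2 ?_
          rintro b ⟨x, hx, rfl, -⟩
          exact hx.2 (mem_biUnion (show j ∈ I from ⟨hj, hjy⟩) (Or.inr ha))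
        · exact (not_infinite.1 ha).subset (fibre_mono sdiff_subset _ _ _) }
  have := BooleanSubalgebra.sup_mem hSX
    (mem_normalAlgebra_of_mem_basicSets hSX'.mem_basicSets)
  rwa [show S ∩ X ⊔ S \ X = S from inter_union_sdiff S X] at this

/-- G factors out, being insensitive to y. For finite slices of P the projection says that a count
is not 0. Otherwise the slice of P is infinite and the same over every x, so finitely many finite
slices cannot cover it and the projection is everything. -/
theorem projection_mem_of_mem_basicSets (hM : IsGeometric L M) {S : Set (V → M)}
    (hS : S ∈ basicSets L B y) : {x | (slice S y x).Nonempty} ∈ cylinderAlgebra L B y := by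
  obtain ⟨G, hG, J, P, l, hP, hl, rfl⟩ := hS
  have hsplit : {x | (slice (G ∩ (P ∩ avoid l)) y x).Nonempty} =
      G ⊓ {x | (slice (P ∩ avoid l) y x).Nonempty} := by
    ext x
    constructor
    · rintro ⟨t, ht1, ht2⟩
      exact ⟨(update_mem_iff_of_mem_cylinderAlgebra hG x t).1 ht1, t, ht2⟩
    · rintro ⟨hx, t, ht⟩
      exact ⟨t, (update_mem_iff_of_mem_cylinderAlgebra hG x t).2 hx, ht⟩
  rw [hsplit]
  refine BooleanSubalgebra.inf_mem hG ?_
  by_cases hfin : ∀ x, (slice P y x).Finite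
  · convert BooleanSubalgebra.compl_mem (mem_cylinderAlgebra_of_count hM
      (fun N hN => (hl N hN).1) hP hfin 0) using 1
    ext x
    have hA : (slice (P ∩ avoid l) y x).Finite :=
      (hfin x).subset (slice_mono inter_subset_left y x)
    simp only [mem_compl_iff, mem_ofPred_eq, ncard_eq_zero hA, nonempty_iff_ne_empty, ne_eq]
  · obtain rfl := hP.eq_singleton_or_finite.resolve_right hfin
    push Not at hfin
    obtain ⟨x₀, hx₀⟩ := hfin
    convert (BooleanSubalgebra.top_mem (L := cylinderAlgebra L B y)) using 1
    refine eq_univ_of_forall fun x => ?_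
    have hinf : (slice P y x).Infinite := Set.Infinite.mono (fun t ht => hP.dep _ _ (fun i hi => by
      rw [Finset.mem_singleton.1 hi]; simp) ht) hx₀
    have hbad : (⋃ N ∈ {N | N ∈ l}, slice N y x).Finite :=
      l.finite_toSet.biUnion fun N hN => (hl N hN).2 x
    obtain ⟨t, ht, hbt⟩ := (hinf.sdiff hbad).nonempty
    exact ⟨t, ht, fun N hN hNt => hbt (mem_biUnion (show N ∈ {N | N ∈ l} from hN) hNt)⟩

theorem projection_mem_of_mem_normalAlgebra (hM : IsGeometric L M) {S : Set (V → M)}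
    (hS : S ∈ normalAlgebra L B y) : {x | (slice S y x).Nonempty} ∈ cylinderAlgebra L B y := by
  obtain ⟨t, ht, hts, rfl⟩ := hS
  refine Finset.sup'_induction
    (p := fun S => {x | (slice S y x).Nonempty} ∈ cylinderAlgebra L B y) ht id ?_ ?_
  · intro S hS T hT
    convert BooleanSubalgebra.sup_mem hS hT using 1
    ext x
    exact exists_or
  · exact fun S hS => projection_mem_of_mem_basicSets hM (hts hS)

variable (L B V) in
/-- The boolean algebra generated by the thin cylinders. -/
def fullCylinderAlgebra : BooleanSubalgebra (Set (V → M)) :=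
  BooleanSubalgebra.closure {S | ∃ J : Finset V, IsThinCylinder L B J S}

/-- Elimination of the variable `y`. -/
theorem projection_mem_cylinderAlgebra [Finite V] (hM : IsGeometric L M)
    (hB : ∀ E : Set M, B.Definable₁ L E → E.Finite → E ⊆ B) {S : Set (V → M)}
    (hS : S ∈ fullCylinderAlgebra L B V) (y : V) :
    {x | (slice S y x).Nonempty} ∈ cylinderAlgebra L B y :=
  projection_mem_of_mem_normalAlgebra hM
    ((BooleanSubalgebra.closure_le (L := normalAlgebra L B y)).2
      (fun T (hT : ∃ J, IsThinCylinder L B J T) => hT.choose_spec.mem_normalAlgebra hM hB) hS)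

end Projection

/-! ### From thin cylinders to formulas of the curve language -/

section CurveLanguage

variable {L : FirstOrder.Language.{u, v}} {M : Type w} [L.Structure M] {B : Set M}

theorem IsThinCylinder.image_comp {V W : Type*} [Finite V] [Finite W] {ι : W → V}
    (hι : Function.Injective ι) {J : Finset V} {S : Set (V → M)} (hS : IsThinCylinder L B J S) :
    IsThinCylinder L B (J.preimage ι hι.injOn) ((fun x => x ∘ ι) '' S) where
  definable := hS.definable.image_comp ι
  dep := by
    rintro _ w' h ⟨x, hx, rfl⟩
    refine ⟨Function.extend ι w' x, hS.dep x _ (fun i hi => ?_) hx, ?_⟩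
    · by_cases hr : ∃ k, ι k = i
      · obtain ⟨k, rfl⟩ := hr
        rw [hι.extend_apply]
        exact h k (Finset.mem_preimage.2 hi)
      · rw [Function.extend_apply' _ _ _ hr]
    · ext k
      exact hι.extend_apply _ _ k
  thin i hi k hk hik := by
    refine (hS.thin (ι i) (Finset.mem_preimage.1 hi) (ι k) (Finset.mem_preimage.1 hk)
      (hι.ne hik)).subset fun a ha => Set.Infinite.mono ?_ ha
    rintro b ⟨_, ⟨x, hx, rfl⟩, rfl, rfl⟩
    exact ⟨x, hx, rfl, rfl⟩

/-- This discards the coordinates outside the range of ι: a generator is recovered from its image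
because it depends only on coordinates in that range. -/
theorem exists_mem_fullCylinderAlgebra_comp {V W : Type*} [Finite V] [Finite W] {ι : W → V}
    (hι : Function.Injective ι) {T : Set (V → M)}
    (hT : T ∈ BooleanSubalgebra.closure
      {S | ∃ J : Finset V, (J : Set V) ⊆ range ι ∧ IsThinCylinder L B J S}) :
    ∃ T' ∈ fullCylinderAlgebra L B W, ∀ x, x ∈ T ↔ x ∘ ι ∈ T' := by
  induction hT using BooleanSubalgebra.closure_bot_sup_induction with
  | mem S hS =>
    obtain ⟨J, hJ, hS⟩ := hS
    refine ⟨_, BooleanSubalgebra.subset_closure ⟨_, hS.image_comp hι⟩, fun x =>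
      ⟨fun hx => ⟨x, hx, rfl⟩, ?_⟩⟩
    rintro ⟨x', hx', h⟩
    refine hS.dep x' x (fun i hi => ?_) hx'
    obtain ⟨k, rfl⟩ := hJ hi
    exact congrFun h k
  | bot => exact ⟨⊥, BooleanSubalgebra.bot_mem, fun x => Iff.rfl⟩
  | sup S _ T _ hS hT =>
    obtain ⟨S', hS', hS⟩ := hS
    obtain ⟨T', hT', hT⟩ := hT
    exact ⟨_, BooleanSubalgebra.sup_mem hS' hT', fun x => or_congr (hS x) (hT x)⟩
  | compl S _ hS =>
    obtain ⟨S', hS', hS⟩ := hS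
    exact ⟨_, BooleanSubalgebra.compl_mem hS', fun x => not_congr (hS x)⟩

theorem isThinCylinder_eq {V : Type*} [DecidableEq V] (i j : V) :
    IsThinCylinder L B {i, j} {x : V → M | x i = x j} where
  definable := (Definable.diagonal L B).preimage_comp ![i, j]
  dep x x' h hx := by
    rw [mem_ofPred_eq, ← h i (by simp), ← h j (by simp)]
    exact hx
  thin k hk l hl hkl := by
    convert finite_empty
    refine eq_empty_iff_forall_notMem.2 fun a ha => ha ((finite_singleton a).subset ?_)
    rintro b ⟨x, hx, rfl, rfl⟩
    have hx : x i = x j := hx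
    simp only [Finset.coe_insert, Finset.coe_singleton, mem_insert_iff, mem_singleton_iff] at hk hl
    rcases hk with rfl | rfl <;> rcases hl with rfl | rfl <;> simp_all

theorem isThinCylinder_comp {V : Type*} [DecidableEq V] {n : ℕ} {C : Set (Fin n → M)}
    (hC : B.Definable L C) (hthin : ThinOn univ C) (σ : Fin n → V) :
    IsThinCylinder L B (Finset.univ.image σ) {x : V → M | x ∘ σ ∈ C} where
  definable := hC.preimage_comp σ
  dep x x' h hx := by
    have : x ∘ σ = x' ∘ σ :=
      funext fun i => h _ (Finset.mem_image_of_mem σ (Finset.mem_univ i))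
    rw [mem_ofPred_eq, ← this]
    exact hx
  thin i hi j hj hij := by
    obtain ⟨i, -, rfl⟩ := Finset.mem_image.1 (Finset.mem_coe.1 hi)
    obtain ⟨j, -, rfl⟩ := Finset.mem_image.1 (Finset.mem_coe.1 hj)
    refine (hthin i trivial j trivial fun h => hij (congrArg σ h)).subset
      fun a ha => Set.Infinite.mono ?_ ha
    rintro b ⟨x, hx, rfl, rfl⟩
    exact ⟨_, hx, rfl, rfl⟩

theorem IsThinCylinder.isCurveBasedCylinder (hM : IsGeometric L M) {n : ℕ} {J : Finset (Fin n)}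
    {S : Set (Fin n → M)} (hS : IsThinCylinder L B J S) : IsCurveBasedCylinder L B S := by
  let i := J.orderEmbOfFin rfl
  have hi : ∀ k, i k ∈ J := J.orderEmbOfFin_mem rfl
  refine ⟨J.card, i, (fun x => x ∘ i) '' S, hM.isCurve_iff.2 ⟨hS.definable.image_comp i, ?_⟩, ?_⟩
  · intro k _ l _ hkl
    refine (hS.thin (i k) (hi k) (i l) (hi l) (i.injective.ne hkl)).subset
      fun a ha => Set.Infinite.mono ?_ ha
    rintro b ⟨_, ⟨x, hx, rfl⟩, rfl, rfl⟩
    exact ⟨x, hx, rfl, rfl⟩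
  · ext x
    refine ⟨fun hx => ⟨x, hx, rfl⟩, ?_⟩
    rintro ⟨x', hx', h⟩
    refine hS.dep x' x (fun j hj => ?_) hx'
    have : j ∈ range i := by
      rw [Finset.range_orderEmbOfFin]
      exact hj
    obtain ⟨k, rfl⟩ := this
    exact congrFun h k

theorem exists_term_eq_var {β : Type*} (t : (curveLanguage L M).Term β) : ∃ b, t = Term.var b := by
  cases t with
  | var b => exact ⟨b, rfl⟩
  | func f => exact Empty.elim f

theorem exists_snoc_mem_fullCylinderAlgebra (hM : IsGeometric L M)
    (hB : ∀ E : Set M, B.Definable₁ L E → E.Finite → E ⊆ B) {α : Type} [Finite α] {k : ℕ}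
    {S : Set (α ⊕ Fin (k + 1) → M)} (hS : S ∈ fullCylinderAlgebra L B (α ⊕ Fin (k + 1))) :
    {x : α ⊕ Fin k → M | ∃ t, Sum.elim (x ∘ Sum.inl) (Fin.snoc (x ∘ Sum.inr) t) ∈ S} ∈
      fullCylinderAlgebra L B (α ⊕ Fin k) := by
  classical
  -- The element t₀ is a mere filler for the eliminated coordinate; if M is empty, so is the
  -- projection.
  rcases isEmpty_or_nonempty M with hM' | ⟨⟨t₀⟩⟩
  · convert (BooleanSubalgebra.bot_mem (L := fullCylinderAlgebra L B (α ⊕ Fin k))) using 1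
    ext x
    simp
  let y : α ⊕ Fin (k + 1) := Sum.inr (Fin.last k)
  let ι : α ⊕ Fin k → α ⊕ Fin (k + 1) := Sum.map id Fin.castSucc
  have hι : Function.Injective ι :=
    Function.Injective.sumMap Function.injective_id (Fin.castSucc_injective k)
  have hmem := projection_mem_cylinderAlgebra hM hB hS y
  obtain ⟨T', hT', h⟩ := exists_mem_fullCylinderAlgebra_comp hι
    (BooleanSubalgebra.closure_mono (fun T (hT : ∃ J, y ∉ J ∧ IsThinCylinder L B J T) => by
      obtain ⟨J, hyJ, hT⟩ := hT
      refine ⟨J, fun j hj => ?_, hT⟩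
      rcases j with a | c
      · exact ⟨Sum.inl a, rfl⟩
      · induction c using Fin.lastCases with
        | last => exact absurd hj hyJ
        | cast c => exact ⟨Sum.inr c, rfl⟩) hmem)
  convert hT' using 1
  ext x
  have h1 := h (Sum.elim (x ∘ Sum.inl) (Fin.snoc (x ∘ Sum.inr) t₀))
  have h2 : Sum.elim (x ∘ Sum.inl) (Fin.snoc (x ∘ Sum.inr) t₀ : Fin (k + 1) → M) ∘ ι = x := by
    ext c
    rcases c with c | c
    · rfl
    · simp [ι]
  rw [h2] at h1
  rw [← h1]
  refine exists_congr fun t => ?_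
  have h3 : Function.update
      (Sum.elim (x ∘ Sum.inl) (Fin.snoc (x ∘ Sum.inr) t₀ : Fin (k + 1) → M)) y t =
      Sum.elim (x ∘ Sum.inl) (Fin.snoc (x ∘ Sum.inr) t : Fin (k + 1) → M) := by
    rw [← update_elim_inr, Fin.update_snoc_last]
  rw [slice, mem_ofPred_eq, h3]

/-- Atomic formulas define thin cylinders, even with repeated variables, and ∀ is the complement of
a projection of a complement. -/
theorem realize_mem_fullCylinderAlgebra (hM : IsGeometric L M) {α : Type} [Finite α] {k : ℕ}
    (φ : (curveLanguage L M).BoundedFormula α k) :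
    {x : α ⊕ Fin k → M | φ.Realize (x ∘ Sum.inl) (x ∘ Sum.inr)} ∈
      fullCylinderAlgebra L (acl L (∅ : Set M)) (α ⊕ Fin k) := by
  classical
  induction φ with
  | falsum => exact BooleanSubalgebra.bot_mem
  | equal t₁ t₂ =>
    obtain ⟨i, rfl⟩ := exists_term_eq_var t₁
    obtain ⟨j, rfl⟩ := exists_term_eq_var t₂
    refine BooleanSubalgebra.subset_closure ⟨{i, j}, ?_⟩
    convert isThinCylinder_eq (L := L) (B := acl L (∅ : Set M)) i j using 1
    ext x
    simp only [mem_ofPred_eq, BoundedFormula.Realize, Term.realize_var, Sum.elim_comp_inl_inr]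
  | rel R ts =>
    choose σ hσ using fun i => exists_term_eq_var (ts i)
    have hR := hM.isCurve_iff.1 R.2
    refine BooleanSubalgebra.subset_closure ⟨Finset.univ.image σ, ?_⟩
    convert isThinCylinder_comp hR.1 hR.2 σ using 1
    ext x
    simp only [mem_ofPred_eq, BoundedFormula.Realize, hσ, Term.realize_var, Sum.elim_comp_inl_inr]
    rfl
  | imp φ ψ hφ hψ =>
    convert BooleanSubalgebra.sup_mem (BooleanSubalgebra.compl_mem hφ) hψ using 1
    ext x
    exact imp_iff_not_or
  | all φ hφ =>
    convert BooleanSubalgebra.compl_mem (exists_snoc_mem_fullCylinderAlgebra hM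
      (fun _ => subset_acl_of_definable) (BooleanSubalgebra.compl_mem hφ)) using 1
    ext x
    simp [BoundedFormula.Realize]

theorem realize_mem_closure_isCurveBasedCylinder (hM : IsGeometric L M) {n : ℕ}
    (φ : (curveLanguage L M).Formula (Fin n)) :
    {x : Fin n → M | φ.Realize x} ∈ BooleanSubalgebra.closure
      {S : Set (Fin n → M) | IsCurveBasedCylinder L (acl L (∅ : Set M)) S} := by
  have h := realize_mem_fullCylinderAlgebra hM φ
  obtain ⟨T', hT', h'⟩ := exists_mem_fullCylinderAlgebra_comp
    (ι := (Sum.inl : Fin n → Fin n ⊕ Fin 0)) Sum.inl_injective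
    (BooleanSubalgebra.closure_mono (fun T (hT : ∃ J, IsThinCylinder L _ J T) => by
      obtain ⟨J, hT⟩ := hT
      refine ⟨J, fun j _ => ?_, hT⟩
      rcases j with a | c
      · exact ⟨a, rfl⟩
      · exact c.elim0) h)
  have hle : fullCylinderAlgebra L (acl L (∅ : Set M)) (Fin n) ≤ BooleanSubalgebra.closure
      {S : Set (Fin n → M) | IsCurveBasedCylinder L (acl L (∅ : Set M)) S} :=
    BooleanSubalgebra.closure_mono fun T (hT : ∃ J, IsThinCylinder L _ J T) =>
      hT.choose_spec.isCurveBasedCylinder hM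
  convert hle hT' using 1
  ext x
  have h1 := h' (Sum.elim x Fin.elim0)
  rw [Sum.elim_comp_inl] at h1
  rw [← h1, mem_ofPred_eq, mem_ofPred_eq, Formula.Realize, Sum.elim_comp_inl]
  exact iff_of_eq (congrArg _ (Subsingleton.elim _ _))

theorem exists_isQF_of_mem_closure {n : ℕ} {S : Set (Fin n → M)}
    (hS : S ∈ BooleanSubalgebra.closure
      {S : Set (Fin n → M) | IsCurveBasedCylinder L (acl L (∅ : Set M)) S}) :
    ∃ ψ : (curveLanguage L M).Formula (Fin n),
      BoundedFormula.IsQF ψ ∧ ∀ x, x ∈ S ↔ ψ.Realize x := by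
  induction hS using BooleanSubalgebra.closure_bot_sup_induction with
  | mem S hS =>
    obtain ⟨m, i, C, hC, rfl⟩ := hS
    let R : (curveLanguage L M).Relations m := ⟨C, hC⟩
    refine ⟨R.formula fun k => Term.var (i k), (BoundedFormula.IsAtomic.rel _ _).isQF, fun x => ?_⟩
    rw [Formula.realize_rel]
    rfl
  | bot => exact ⟨⊥, BoundedFormula.isQF_bot, fun x => Iff.rfl⟩
  | sup S _ T _ hS hT =>
    obtain ⟨ψ, hψ, hS⟩ := hS
    obtain ⟨χ, hχ, hT⟩ := hT
    refine ⟨ψ ⊔ χ, hψ.sup hχ, fun x => ?_⟩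
    rw [Formula.realize_sup]
    exact or_congr (hS x) (hT x)
  | compl S _ hS =>
    obtain ⟨ψ, hψ, hS⟩ := hS
    refine ⟨ψ.not, hψ.not, fun x => ?_⟩
    rw [Formula.realize_not]
    exact not_congr (hS x)

end CurveLanguage

end GeometricCurves

theorem theorem3p5 {L : FirstOrder.Language.{u, v}} {M : Type w} [L.Structure M]
    (hM : GeometricCurves.IsGeometric L M) :
    GeometricCurves.HasQE (GeometricCurves.curveLanguage L M) M ∧
    ∀ (n : ℕ) (φ : (GeometricCurves.curveLanguage L M).Formula (Fin n)),
      {x : Fin n → M | φ.Realize x} ∈ BooleanSubalgebra.closure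
        {S : Set (Fin n → M) |
          GeometricCurves.IsCurveBasedCylinder L (GeometricCurves.acl L (∅ : Set M)) S} :=
  ⟨fun _ φ => GeometricCurves.exists_isQF_of_mem_closure
    (GeometricCurves.realize_mem_closure_isCurveBasedCylinder hM φ),
    fun _ φ => GeometricCurves.realize_mem_closure_isCurveBasedCylinder hM φ⟩
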